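/- Let $K$ be a field of characteristic $0$ and let $A_1$ be the first Weyl algebra over $K$, generated by $p,q$ subject to $pq-qp=1$. The elements $p^iq^j$ ($i,j\ge 0$) form a basis of $A_1$; let $\Phi:A_1\to K[X,Y]$ be the $K$-linear isomorphism with $\Phi(p^iq^j)=X^iY^j$. For $h=\sum\alpha_{ij}X^iY^j\in K[X,Y]$ put $E(h)=\{(i,j):\alpha_{ij}\neq 0\}$. For $z\in A_1\setminus\{0\}$ and $(\rho,\sigma)\in\mathbb{R}^2$ with $\rho+\sigma>0$, write $\Phi(z)=\sum\alpha_{ij}X^iY^j$, let $\mathbf{v}_{\rho,\sigma}(z)=\sup\{\rho i+\sigma j:(i,j)\in E(\Phi(z))\}$, and let $$\mathbf{f}_{\rho,\sigma}(z)=\sum_{(i,j)\in E(\Phi(z)),\ \rho i+\sigma j=\mathbf{v}_{\rho,\sigma}(z)}\alpha_{ij}X^iY^j$$ be its $(\rho,\sigma)$-leading component. Let $z,w\in A_1$ with $z\neq 0$ and $[z,w]=zw-wz=1$, and let $f=\mathbf{f}_{\rho,\sigma}(z)$ for some $(\rho,\sigma)\in\mathbb{R}^2$ with $\rho+\sigma>0$.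 (1) If $|E(f)|=2$, then $z$ and $w$ generate $A_1$ as a $K$-algebra. (2) If $f=\lambda X^iY^j$ with $\lambda\in K\setminus\{0\}$, $i\ge 1$, $j\ge 1$ and $\gcd(i,j)=1$, then $z$ and $w$ generate $A_1$ as a $K$-algebra. -/

import Mathlib

namespace FirstWeyl

/-- The defining relation `p q = q p + 1` of the first Weyl algebra, imposed on the free algebra
on two generators (index `0` is `p`, index `1` is `q`). -/
inductive WeylRel (K : Type*) [CommRing K] :
    FreeAlgebra K (Fin 2) → FreeAlgebra K (Fin 2) → Prop
  | comm : WeylRel K (FreeAlgebra.ι K 0 * FreeAlgebra.ι K 1)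
      (FreeAlgebra.ι K 1 * FreeAlgebra.ι K 0 + 1)

/-- The first Weyl algebra `A₁` over `K`: generators `p, q` and the relation `p q - q p = 1`. -/
def WeylAlgebra (K : Type*) [CommRing K] : Type _ := RingQuot (WeylRel K)

namespace WeylAlgebra

instance instRing (K : Type*) [CommRing K] : Ring (WeylAlgebra K) :=
  inferInstanceAs (Ring (RingQuot (WeylRel K)))

instance instAlgebra (K : Type*) [CommRing K] : Algebra K (WeylAlgebra K) :=
  inferInstanceAs (Algebra K (RingQuot (WeylRel K)))

/-- The quotient map from the free algebra. -/
def mk (K : Type*) [CommRing K] : FreeAlgebra K (Fin 2) →ₐ[K] WeylAlgebra K :=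
  RingQuot.mkAlgHom K (WeylRel K)

/-- The generator `p`. -/
def p (K : Type*) [CommRing K] : WeylAlgebra K := mk K (FreeAlgebra.ι K 0)

/-- The generator `q`. -/
def q (K : Type*) [CommRing K] : WeylAlgebra K := mk K (FreeAlgebra.ι K 1)

theorem p_mul_q (K : Type*) [CommRing K] : p K * q K = q K * p K + 1 := by
  have h : mk K (FreeAlgebra.ι K 0 * FreeAlgebra.ι K 1)
      = mk K (FreeAlgebra.ι K 1 * FreeAlgebra.ι K 0 + 1) :=
    RingQuot.mkAlgHom_rel K WeylRel.comm
  simpa only [map_mul, map_add, map_one, p, q] using h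

theorem mk_surjective (K : Type*) [CommRing K] : Function.Surjective (mk K) :=
  RingQuot.mkAlgHom_surjective K (WeylRel K)

/-- The `K`-linear map `K[X,Y] → A₁`, `∑ αᵢⱼ XⁱYʲ ↦ ∑ αᵢⱼ pⁱqʲ`
(`X` is the variable `0`, `Y` is the variable `1`). -/
noncomputable def ofPoly (K : Type*) [CommRing K] :
    MvPolynomial (Fin 2) K →ₗ[K] WeylAlgebra K :=
  (MvPolynomial.basisMonomials (Fin 2) K).constr K fun m => p K ^ m 0 * q K ^ m 1

theorem ofPoly_monomial (K : Type*) [CommRing K] (m : Fin 2 →₀ ℕ) (a : K) :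
    ofPoly K (MvPolynomial.monomial m a) = a • (p K ^ m 0 * q K ^ m 1) := by
  have h : ofPoly K (MvPolynomial.monomial m 1) = p K ^ m 0 * q K ^ m 1 := by
    have := (MvPolynomial.basisMonomials (Fin 2) K).constr_basis K
      (fun m => p K ^ m 0 * q K ^ m 1) m
    simpa [ofPoly, MvPolynomial.coe_basisMonomials] using this
  rw [← h, ← map_smul, MvPolynomial.smul_monomial, smul_eq_mul, mul_one]

/-- The action of `A₁` on `K[X,Y]` in which `p` is multiplication by `X` and `q` is
multiplication by `Y` minus `∂/∂X`; an auxiliary map that shows the independence of the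
`pⁱqʲ`. -/
noncomputable def action (K : Type*) [CommRing K] :
    WeylAlgebra K →ₐ[K] Module.End K (MvPolynomial (Fin 2) K) :=
  RingQuot.liftAlgHom K
    ⟨FreeAlgebra.lift K
      ![LinearMap.mulLeft K (MvPolynomial.X 0),
        LinearMap.mulLeft K (MvPolynomial.X 1) - (MvPolynomial.pderiv 0).toLinearMap], by
      intro x y h
      cases h
      refine LinearMap.ext fun f => ?_
      simp only [map_mul, map_add, map_one, FreeAlgebra.lift_ι_apply, Matrix.cons_val_zero,
        Matrix.cons_val_one, Module.End.mul_apply, LinearMap.add_apply, LinearMap.sub_apply,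
        LinearMap.mulLeft_apply, Module.End.one_apply, Derivation.coeFn_coe,
        Derivation.leibniz, MvPolynomial.pderiv_X_self, smul_eq_mul]
      ring⟩

theorem action_p (K : Type*) [CommRing K] (f : MvPolynomial (Fin 2) K) :
    action K (p K) f = MvPolynomial.X 0 * f := by
  simp only [action, p, mk]
  erw [RingQuot.liftAlgHom_mkAlgHom_apply]
  simp

theorem action_q (K : Type*) [CommRing K] (f : MvPolynomial (Fin 2) K) :
    action K (q K) f = MvPolynomial.X 1 * f - MvPolynomial.pderiv 0 f := by
  simp only [action, q, mk]
  erw [RingQuot.liftAlgHom_mkAlgHom_apply]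
  simp

theorem action_monomial (K : Type*) [CommRing K] (i j : ℕ) :
    action K (p K ^ i * q K ^ j) 1 = MvPolynomial.X 0 ^ i * MvPolynomial.X 1 ^ j := by
  have hq : action K (q K ^ j) 1 = MvPolynomial.X 1 ^ j := by
    induction j with
    | zero => simp
    | succ j ih =>
      rw [pow_succ', map_mul, Module.End.mul_apply, ih, action_q]
      simp [pow_succ']
  rw [map_mul, Module.End.mul_apply, hq]
  induction i with
  | zero => simp
  | succ i ih => rw [pow_succ', map_mul, Module.End.mul_apply, ih, action_p, pow_succ', mul_assoc]

theorem action_ofPoly (K : Type*) [CommRing K] (f : MvPolynomial (Fin 2) K) :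
    action K (ofPoly K f) 1 = f := by
  induction f using MvPolynomial.induction_on' with
  | monomial m a =>
    rw [ofPoly_monomial, map_smul, LinearMap.smul_apply, action_monomial,
      MvPolynomial.monomial_eq, MvPolynomial.smul_eq_C_mul]
    simp [Finsupp.prod_fintype, Fin.prod_univ_two]
  | add f g hf hg => rw [map_add, map_add, LinearMap.add_apply, hf, hg]

theorem q_mul_p_pow (K : Type*) [CommRing K] (i : ℕ) :
    q K * p K ^ i = p K ^ i * q K - (i : K) • p K ^ (i - 1) := by
  have hqp : q K * p K = p K * q K - 1 := by rw [p_mul_q]; abel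
  induction i with
  | zero => simp
  | succ i ih =>
    rw [pow_succ, ← mul_assoc, ih, sub_mul, mul_assoc, hqp]
    rcases i with _ | i
    · simp
    · rw [Nat.add_sub_cancel, Nat.add_sub_cancel, smul_mul_assoc, ← pow_succ, mul_sub, mul_one,
        ← mul_assoc, Nat.cast_succ (i + 1), add_smul, one_smul]
      abel

theorem monomial_mem_range (K : Type*) [CommRing K] (i j : ℕ) :
    p K ^ i * q K ^ j ∈ LinearMap.range (ofPoly K) :=
  ⟨MvPolynomial.monomial (Finsupp.single 0 i + Finsupp.single 1 j) 1, by
    rw [ofPoly_monomial]; simp⟩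

theorem p_mul_mem_range (K : Type*) [CommRing K] {x : WeylAlgebra K}
    (hx : x ∈ LinearMap.range (ofPoly K)) : p K * x ∈ LinearMap.range (ofPoly K) := by
  obtain ⟨f, rfl⟩ := hx
  induction f using MvPolynomial.induction_on' with
  | monomial m a =>
    rw [ofPoly_monomial, mul_smul_comm, ← mul_assoc, ← pow_succ']
    exact Submodule.smul_mem _ _ (monomial_mem_range K _ _)
  | add f g hf hg => rw [map_add, mul_add]; exact Submodule.add_mem _ hf hg

theorem q_mul_mem_range (K : Type*) [CommRing K] {x : WeylAlgebra K}
    (hx : x ∈ LinearMap.range (ofPoly K)) : q K * x ∈ LinearMap.range (ofPoly K) := by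
  obtain ⟨f, rfl⟩ := hx
  induction f using MvPolynomial.induction_on' with
  | monomial m a =>
    rw [ofPoly_monomial, mul_smul_comm, ← mul_assoc, q_mul_p_pow, sub_mul, mul_assoc,
      ← pow_succ', smul_mul_assoc]
    exact Submodule.smul_mem _ _ (Submodule.sub_mem _ (monomial_mem_range K _ _)
      (Submodule.smul_mem _ _ (monomial_mem_range K _ _)))
  | add f g hf hg => rw [map_add, mul_add]; exact Submodule.add_mem _ hf hg

theorem ofPoly_bijective (K : Type*) [CommRing K] : Function.Bijective (ofPoly K) := by
  constructor
  · intro f g h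
    rw [← action_ofPoly K f, h, action_ofPoly]
  · intro z
    obtain ⟨a, rfl⟩ := mk_surjective K z
    have key : ∀ x ∈ LinearMap.range (ofPoly K), mk K a * x ∈ LinearMap.range (ofPoly K) := by
      induction a using FreeAlgebra.induction with
      | grade0 r =>
        intro x hx
        rw [AlgHom.commutes, ← Algebra.smul_def]
        exact Submodule.smul_mem _ _ hx
      | grade1 i =>
        intro x hx
        fin_cases i
        · exact p_mul_mem_range K hx
        · exact q_mul_mem_range K hx
      | mul a b ha hb =>
        intro x hx
        rw [map_mul, mul_assoc]
        exact ha _ (hb _ hx)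
      | add a b ha hb =>
        intro x hx
        rw [map_add, add_mul]
        exact Submodule.add_mem _ (ha _ hx) (hb _ hx)
    have h1 := key 1 (by simpa using monomial_mem_range K 0 0)
    rw [mul_one] at h1
    exact h1

/-- The linear isomorphism `Φ : A₁ → K[X,Y]`, `pⁱqʲ ↦ XⁱYʲ`. -/
noncomputable def Φ (K : Type*) [CommRing K] : WeylAlgebra K ≃ₗ[K] MvPolynomial (Fin 2) K :=
  (LinearEquiv.ofBijective (ofPoly K) (ofPoly_bijective K)).symm

end WeylAlgebra

/-- The value `ρ i + σ j` on the exponent `(i, j)`. -/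
noncomputable def weight (ρ σ : ℝ) (m : Fin 2 →₀ ℕ) : ℝ := ρ * (m 0 : ℝ) + σ * (m 1 : ℝ)

/-- The support `E(f)`: the exponents of the monomials with nonzero coefficient. -/
def E {K : Type*} [CommRing K] (f : MvPolynomial (Fin 2) K) : Finset (Fin 2 →₀ ℕ) := f.support

/-- The `(ρ,σ)`-degree `sup {ρ i + σ j | (i,j) ∈ E(f)}`. -/
noncomputable def degree {K : Type*} [CommRing K] (ρ σ : ℝ) (f : MvPolynomial (Fin 2) K) : ℝ :=
  sSup (weight ρ σ '' (E f : Set (Fin 2 →₀ ℕ)))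

open Classical in
/-- The `(ρ,σ)`-leading component of a polynomial: the sum of its terms of maximal weight. -/
noncomputable def leadingComponent {K : Type*} [CommRing K] (ρ σ : ℝ)
    (f : MvPolynomial (Fin 2) K) : MvPolynomial (Fin 2) K :=
  ∑ m ∈ (E f).filter (fun m => weight ρ σ m = degree ρ σ f),
    MvPolynomial.monomial m (f.coeff m)

/-- The polynomial `(ρ,σ)`-associated with `z ∈ A₁`. -/
noncomputable def associatedPoly {K : Type*} [CommRing K] (ρ σ : ℝ) (z : WeylAlgebra K) :
    MvPolynomial (Fin 2) K :=
  leadingComponent ρ σ (WeylAlgebra.Φ K z)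

end FirstWeyl

/-! Carried to K[X,Y] by `Φ`, the product of A₁ is fg − f_Y g_X up to terms whose weight is lower by
2(ρ+σ). Hence the commutator is, to leading order, the Poisson bracket {f,g}. If [z,w] = 1 and f, g
are the leading components of z, w, then {f,g} is either 0 or 1 (`bracket_eq_one_of_ne_zero`), and
deg z + deg w ≥ ρ+σ > 0 in any case.

The case {f,g} = 0 can be removed. Let v = deg f. If v ≤ 0, any g commuting with f has an exponent
of weight ≤ 0, against the degree inequality. If v > 0, any g commuting with f has an exponent nP,
where P is a fixed exponent of f; subtracting multiples of zⁿ from w preserves [z,w] = 1 and must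
eventually lead to {f,g} = 1 (`exists_bracket_ne_zero_of_pos`). Both facts about commuting g come
from lattice geometry: a bracket with a monomial of exponent P translates exponents by P − (1,1) and
multiplies coefficients by determinants, so extreme points of the support of g must be parallel to
exponents of f.

If f is a binomial and {f,g} = 1, the same geometry forces f = aX_k + bX_l^d
(`exponents_of_bracket_eq_one`). The degrees then leave so few terms in z and w that both generators
can be solved for (`adjoin_eq_top_of_binomial`). If f is a monomial with coprime positive exponents,
{f,g} = 1 is impossible, so the second claim is vacuous (`not_isTop_monomial`). -/

namespace FirstWeyl

open MvPolynomial WeylAlgebra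

/-- The Poisson bracket on `K[X,Y]`. -/
noncomputable def bracket {K : Type*} [CommRing K] (f g : MvPolynomial (Fin 2) K) :
    MvPolynomial (Fin 2) K :=
  pderiv 0 f * pderiv 1 g - pderiv 1 f * pderiv 0 g

section Bracket

variable {K : Type*} [CommRing K]

theorem bracket_add_left (f₁ f₂ g : MvPolynomial (Fin 2) K) :
    bracket (f₁ + f₂) g = bracket f₁ g + bracket f₂ g := by
  simp only [bracket, map_add]; ring

theorem bracket_pow_self (f : MvPolynomial (Fin 2) K) (n : ℕ) : bracket f (f ^ n) = 0 := by
  simp only [bracket, Derivation.leibniz_pow, smul_eq_mul, nsmul_eq_mul]; ring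

end Bracket

/-! ### Polynomials with prescribed weights. -/

section WeightSupported

variable {K : Type*} [CommRing K] {ρ σ : ℝ}

theorem weight_add (m n : Fin 2 →₀ ℕ) : weight ρ σ (m + n) = weight ρ σ m + weight ρ σ n := by
  simp [weight]; ring

theorem weight_nsmul (n : ℕ) (m : Fin 2 →₀ ℕ) : weight ρ σ (n • m) = n * weight ρ σ m := by
  simp [weight]; ring

theorem weight_zero : weight ρ σ 0 = 0 := by simp [weight]

/-- The polynomials all of whose exponents have weight in `I`. -/
def weightSupported (K : Type*) [CommRing K] (ρ σ : ℝ) (I : Set ℝ) :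
    Submodule K (MvPolynomial (Fin 2) K) where
  carrier := {f | ∀ m, coeff m f ≠ 0 → weight ρ σ m ∈ I}
  zero_mem' := by simp
  add_mem' := by
    intro f g hf hg m hm
    by_cases h : coeff m f = 0
    · exact hg m fun h' => hm (by simp [h, h'])
    · exact hf m h
  smul_mem' := by
    intro c f hf m hm
    exact hf m fun h => hm (by simp [h])

theorem coeff_eq_zero_of_mem {I : Set ℝ} {f : MvPolynomial (Fin 2) K}
    (hf : f ∈ weightSupported K ρ σ I) {m : Fin 2 →₀ ℕ} (hm : weight ρ σ m ∉ I) :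
    coeff m f = 0 :=
  by_contra fun h => hm (hf m h)

theorem weightSupported_mono {I J : Set ℝ} (h : I ⊆ J) :
    weightSupported K ρ σ I ≤ weightSupported K ρ σ J :=
  fun _ hf m hm => h (hf m hm)

theorem monomial_mem_weightSupported {I : Set ℝ} {m : Fin 2 →₀ ℕ} (a : K)
    (h : weight ρ σ m ∈ I) : monomial m a ∈ weightSupported K ρ σ I := by
  classical
  intro n hn
  rw [coeff_monomial] at hn
  split_ifs at hn with hmn
  · rwa [← hmn]
  · exact absurd rfl hn

theorem mul_mem_weightSupported {I J L : Set ℝ} {f g : MvPolynomial (Fin 2) K}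
    (hf : f ∈ weightSupported K ρ σ I) (hg : g ∈ weightSupported K ρ σ J)
    (h : ∀ a ∈ I, ∀ b ∈ J, a + b ∈ L) : f * g ∈ weightSupported K ρ σ L := by
  classical
  intro m hm
  rw [coeff_mul] at hm
  obtain ⟨⟨a, b⟩, hab, hne⟩ := Finset.exists_ne_zero_of_sum_ne_zero hm
  rw [← Finset.HasAntidiagonal.mem_antidiagonal.mp hab, weight_add]
  exact h _ (hf _ (left_ne_zero_of_mul hne)) _ (hg _ (right_ne_zero_of_mul hne))

theorem pderiv_zero_mem_weightSupported {I J : Set ℝ} {f : MvPolynomial (Fin 2) K}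
    (hf : f ∈ weightSupported K ρ σ I) (h : ∀ a ∈ I, a - ρ ∈ J) :
    pderiv 0 f ∈ weightSupported K ρ σ J := by
  intro m hm
  rw [coeff_pderiv] at hm
  have := h _ (hf _ (left_ne_zero_of_mul hm))
  rw [weight_add] at this
  simpa [weight] using this

theorem pderiv_one_mem_weightSupported {I J : Set ℝ} {f : MvPolynomial (Fin 2) K}
    (hf : f ∈ weightSupported K ρ σ I) (h : ∀ a ∈ I, a - σ ∈ J) :
    pderiv 1 f ∈ weightSupported K ρ σ J := by
  intro m hm
  rw [coeff_pderiv] at hm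
  have := h _ (hf _ (left_ne_zero_of_mul hm))
  rw [weight_add] at this
  simpa [weight] using this

theorem bracket_mem_weightSupported {I J L : Set ℝ} {f g : MvPolynomial (Fin 2) K}
    (hf : f ∈ weightSupported K ρ σ I) (hg : g ∈ weightSupported K ρ σ J)
    (h : ∀ a ∈ I, ∀ b ∈ J, a + b - (ρ + σ) ∈ L) : bracket f g ∈ weightSupported K ρ σ L := by
  refine Submodule.sub_mem _
    (mul_mem_weightSupported (I := (· - ρ) '' I) (J := (· - σ) '' J)
      (pderiv_zero_mem_weightSupported hf fun a ha => ⟨a, ha, rfl⟩)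
      (pderiv_one_mem_weightSupported hg fun a ha => ⟨a, ha, rfl⟩) ?_)
    (mul_mem_weightSupported (I := (· - σ) '' I) (J := (· - ρ) '' J)
      (pderiv_one_mem_weightSupported hf fun a ha => ⟨a, ha, rfl⟩)
      (pderiv_zero_mem_weightSupported hg fun a ha => ⟨a, ha, rfl⟩) ?_)
  · rintro _ ⟨a, ha, rfl⟩ _ ⟨b, hb, rfl⟩
    convert h a ha b hb using 1
    ring
  · rintro _ ⟨a, ha, rfl⟩ _ ⟨b, hb, rfl⟩
    convert h a ha b hb using 1
    ring

theorem weightSupported_induction {I : Set ℝ} {C : MvPolynomial (Fin 2) K → Prop}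
    (zero : C 0) (add : ∀ f g, C f → C g → C (f + g))
    (mono : ∀ m a, weight ρ σ m ∈ I → C (monomial m a))
    {f : MvPolynomial (Fin 2) K} (hf : f ∈ weightSupported K ρ σ I) : C f := by
  rw [f.as_sum]
  exact Finset.sum_induction _ C add zero
    fun m hm => mono m _ (hf m (mem_support_iff.mp hm))

end WeightSupported

/-! ### The product of A₁ on K[X,Y] and its Poisson approximation. -/

section Star

variable {K : Type*} [CommRing K] {ρ σ : ℝ}

theorem ofPoly_Φ (z : WeylAlgebra K) : ofPoly K (Φ K z) = z :=
  (LinearEquiv.ofBijective (ofPoly K) (ofPoly_bijective K)).apply_symm_apply z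

/-- Evaluation of the action at 1 inverts `ofPoly`, so `action` is left multiplication transported
by `Φ`. -/
theorem Φ_mul (z w : WeylAlgebra K) : Φ K (z * w) = action K z (Φ K w) := by
  rw [← action_ofPoly K (Φ K (z * w)), ofPoly_Φ, map_mul, Module.End.mul_apply]
  conv_lhs => rw [← ofPoly_Φ w, action_ofPoly]

theorem Φ_one : Φ K (1 : WeylAlgebra K) = 1 := by
  rw [← action_ofPoly K (Φ K 1), ofPoly_Φ, map_one (action K), Module.End.one_apply]

theorem X_zero_pow_mem (i : ℕ) :
    (X 0 ^ i : MvPolynomial (Fin 2) K) ∈ weightSupported K ρ σ {ρ * i} := by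
  rw [X_pow_eq_monomial]
  exact monomial_mem_weightSupported _ (by simp [weight])

theorem X_one_pow_mem (j : ℕ) :
    (X 1 ^ j : MvPolynomial (Fin 2) K) ∈ weightSupported K ρ σ {σ * j} := by
  rw [X_pow_eq_monomial]
  exact monomial_mem_weightSupported _ (by simp [weight])

/-- The operator is (Y − ∂_X)^j. Each factor Y replaced by ∂_X costs ρ+σ in weight, and the terms
with at most one such replacement are subtracted. -/
theorem action_q_pow_sub_mem (hρσ : 0 ≤ ρ + σ) {b : ℝ} {g : MvPolynomial (Fin 2) K}
    (hg : g ∈ weightSupported K ρ σ (Set.Iic b)) (j : ℕ) :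
    action K (q K ^ j) g - (X 1 ^ j * g - pderiv 1 (X 1 ^ j) * pderiv 0 g) ∈
      weightSupported K ρ σ (Set.Iic (σ * j + b - 2 * (ρ + σ))) := by
  induction j with
  | zero => simp
  | succ j ih =>
    set R := action K (q K ^ j) g - (X 1 ^ j * g - pderiv 1 (X 1 ^ j) * pderiv 0 g) with hR
    have e : action K (q K ^ (j + 1)) g
          - (X 1 ^ (j + 1) * g - pderiv 1 (X 1 ^ (j + 1)) * pderiv 0 g)
        = X 1 ^ 1 * R - pderiv 0 R + pderiv 1 (X 1 ^ j) * pderiv 0 (pderiv 0 g) := by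
      have e1 : action K (q K ^ j) g
          = R + (X 1 ^ j * g - pderiv 1 (X 1 ^ j) * pderiv 0 g) := by rw [hR]; ring
      have h01 : pderiv 0 (X 1 : MvPolynomial (Fin 2) K) = 0 := pderiv_X_of_ne (by decide)
      rw [pow_succ' (q K), map_mul, Module.End.mul_apply, e1, action_q]
      simp only [map_add, map_sub, Derivation.leibniz, Derivation.leibniz_pow, pderiv_X_self,
        smul_eq_mul, nsmul_eq_mul, h01, pow_succ, Derivation.map_natCast, Derivation.map_one_eq_zero]
      ring
    rw [e]
    refine Submodule.add_mem _ (Submodule.sub_mem _ ?_ ?_) ?_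
    · refine mul_mem_weightSupported (X_one_pow_mem 1) ih ?_
      rintro _ rfl c hc
      simp only [Set.mem_Iic] at hc ⊢
      push_cast at hc ⊢
      linarith
    · refine pderiv_zero_mem_weightSupported ih ?_
      intro c hc
      simp only [Set.mem_Iic] at hc ⊢
      push_cast at hc ⊢
      linarith
    · refine mul_mem_weightSupported (J := Set.Iic (b - ρ - ρ))
        (pderiv_one_mem_weightSupported (J := {σ * j - σ}) (X_one_pow_mem j) ?_)
        (pderiv_zero_mem_weightSupported (I := Set.Iic (b - ρ))
          (pderiv_zero_mem_weightSupported hg ?_) ?_) ?_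
      · rintro _ rfl
        rfl
      · intro c hc
        simpa using hc
      · intro c hc
        simpa using hc
      · rintro _ rfl c hc
        simp only [Set.mem_Iic] at hc ⊢
        push_cast at hc ⊢
        linarith

theorem action_p_pow (i : ℕ) (g : MvPolynomial (Fin 2) K) :
    action K (p K ^ i) g = X 0 ^ i * g := by
  induction i with
  | zero => simp
  | succ i ih => rw [pow_succ', map_mul, Module.End.mul_apply, ih, action_p]; ring

/-- The product of `A₁` transported to `K[X,Y]`, up to terms of second order. -/
theorem action_ofPoly_sub_mem (hρσ : 0 ≤ ρ + σ) {a b : ℝ} {h g : MvPolynomial (Fin 2) K}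
    (hh : h ∈ weightSupported K ρ σ (Set.Iic a)) (hg : g ∈ weightSupported K ρ σ (Set.Iic b)) :
    action K (ofPoly K h) g - (h * g - pderiv 1 h * pderiv 0 g) ∈
      weightSupported K ρ σ (Set.Iic (a + b - 2 * (ρ + σ))) := by
  refine weightSupported_induction (C := fun h =>
    action K (ofPoly K h) g - (h * g - pderiv 1 h * pderiv 0 g) ∈
      weightSupported K ρ σ (Set.Iic (a + b - 2 * (ρ + σ)))) ?_ ?_ ?_ hh
  · simp
  · intro f₁ f₂ h₁ h₂
    convert Submodule.add_mem _ h₁ h₂ using 1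
    simp only [map_add, LinearMap.add_apply]
    ring
  · intro m c hm
    have e : (monomial m c : MvPolynomial (Fin 2) K) = C c * (X 0 ^ m 0 * X 1 ^ m 1) := by
      rw [monomial_eq]; simp [Finsupp.prod_fintype, Fin.prod_univ_two]
    have h10 : pderiv 1 (X 0 : MvPolynomial (Fin 2) K) = 0 := pderiv_X_of_ne (by decide)
    have key : action K (ofPoly K (monomial m c)) g
          - (monomial m c * g - pderiv 1 (monomial m c) * pderiv 0 g)
        = c • (X 0 ^ m 0 * (action K (q K ^ m 1) g
          - (X 1 ^ m 1 * g - pderiv 1 (X 1 ^ m 1) * pderiv 0 g))) := by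
      rw [ofPoly_monomial, map_smul, LinearMap.smul_apply, map_mul, Module.End.mul_apply,
        action_p_pow, e, pderiv_C_mul, smul_eq_C_mul, smul_eq_C_mul]
      simp only [Derivation.leibniz, Derivation.leibniz_pow, h10, smul_eq_mul, nsmul_eq_mul]
      ring
    rw [key]
    refine Submodule.smul_mem _ _ (mul_mem_weightSupported (X_zero_pow_mem _)
      (action_q_pow_sub_mem hρσ hg _) ?_)
    rintro _ rfl d hd
    simp only [Set.mem_Iic, weight] at hd hm ⊢
    linarith

theorem Φ_mul_sub_mem (hρσ : 0 ≤ ρ + σ) {a b : ℝ} {z w : WeylAlgebra K}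
    (hz : Φ K z ∈ weightSupported K ρ σ (Set.Iic a))
    (hw : Φ K w ∈ weightSupported K ρ σ (Set.Iic b)) :
    Φ K (z * w) - (Φ K z * Φ K w - pderiv 1 (Φ K z) * pderiv 0 (Φ K w)) ∈
      weightSupported K ρ σ (Set.Iic (a + b - 2 * (ρ + σ))) := by
  have := action_ofPoly_sub_mem hρσ hz hw
  rwa [ofPoly_Φ, ← Φ_mul] at this

theorem Φ_commutator_sub_bracket_mem (hρσ : 0 ≤ ρ + σ) {a b : ℝ} {z w : WeylAlgebra K}
    (hz : Φ K z ∈ weightSupported K ρ σ (Set.Iic a))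
    (hw : Φ K w ∈ weightSupported K ρ σ (Set.Iic b)) :
    Φ K (z * w - w * z) - bracket (Φ K z) (Φ K w) ∈
      weightSupported K ρ σ (Set.Iic (a + b - 2 * (ρ + σ))) := by
  have h₁ := Φ_mul_sub_mem hρσ hz hw
  have h₂ := Φ_mul_sub_mem hρσ hw hz
  rw [add_comm b a] at h₂
  convert Submodule.sub_mem _ h₁ h₂ using 1
  rw [map_sub, bracket]
  ring

end Star

/-! ### Leading components of products and commutators. -/

section Leading

variable {K : Type*} [CommRing K] {ρ σ : ℝ}

/-- `f` is the part of `h` of weight `r`, all other terms of `h` having smaller weight. -/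
def IsTop (ρ σ r : ℝ) (h f : MvPolynomial (Fin 2) K) : Prop :=
  f ∈ weightSupported K ρ σ {r} ∧ h - f ∈ weightSupported K ρ σ (Set.Iio r)

theorem IsTop.mem_Iic {r : ℝ} {h f : MvPolynomial (Fin 2) K} (H : IsTop ρ σ r h f) :
    h ∈ weightSupported K ρ σ (Set.Iic r) := by
  rw [← sub_add_cancel h f]
  exact Submodule.add_mem _ (weightSupported_mono Set.Iio_subset_Iic_self H.2)
    (weightSupported_mono (by simp) H.1)

theorem IsTop.coeff_eq {r : ℝ} {h f : MvPolynomial (Fin 2) K} (H : IsTop ρ σ r h f)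
    {m : Fin 2 →₀ ℕ} (hm : weight ρ σ m = r) : coeff m h = coeff m f := by
  have := coeff_eq_zero_of_mem H.2 (m := m) (by simp [hm])
  rwa [coeff_sub, sub_eq_zero] at this

theorem coeff_leadingComponent (h : MvPolynomial (Fin 2) K) (m : Fin 2 →₀ ℕ)
    [Decidable (weight ρ σ m = degree ρ σ h)] :
    coeff m (leadingComponent ρ σ h) = if weight ρ σ m = degree ρ σ h then coeff m h else 0 := by
  classical
  simp only [leadingComponent, coeff_sum, coeff_monomial, Finset.sum_ite_eq', Finset.mem_filter,
    E, mem_support_iff]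
  by_cases h0 : coeff m h = 0 <;> simp [h0]

theorem weight_le_degree {h : MvPolynomial (Fin 2) K} {m : Fin 2 →₀ ℕ} (hm : coeff m h ≠ 0) :
    weight ρ σ m ≤ degree ρ σ h :=
  le_csSup (((E h).finite_toSet.image _).bddAbove) ⟨m, by simpa [E] using hm, rfl⟩

theorem isTop_leadingComponent (h : MvPolynomial (Fin 2) K) :
    IsTop ρ σ (degree ρ σ h) h (leadingComponent ρ σ h) := by
  classical
  constructor
  · intro m hm
    rw [coeff_leadingComponent] at hm
    by_contra h'
    exact hm (if_neg h')
  · intro m hm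
    rw [coeff_sub, coeff_leadingComponent] at hm
    split_ifs at hm with h'
    · exact absurd (sub_self _) hm
    · rw [sub_zero] at hm
      exact lt_of_le_of_ne (weight_le_degree hm) h'

theorem leadingComponent_ne_zero {h : MvPolynomial (Fin 2) K} (hh : h ≠ 0) :
    leadingComponent ρ σ h ≠ 0 := by
  classical
  have hne : (weight ρ σ '' (E h : Set (Fin 2 →₀ ℕ))).Nonempty := by
    simpa [E, Finset.nonempty_iff_ne_empty] using hh
  obtain ⟨m, hm, hmd⟩ := hne.csSup_mem ((E h).finite_toSet.image _)
  intro h0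
  have := coeff_leadingComponent (ρ := ρ) (σ := σ) h m
  rw [h0, if_pos (show weight ρ σ m = degree ρ σ h from hmd), coeff_zero] at this
  exact (by simpa [E] using hm : coeff m h ≠ 0) this.symm

theorem IsTop.mul (hρσ : 0 < ρ + σ) {a b : ℝ} {z w : WeylAlgebra K}
    {f g : MvPolynomial (Fin 2) K} (hz : IsTop ρ σ a (Φ K z) f) (hw : IsTop ρ σ b (Φ K w) g) :
    IsTop ρ σ (a + b) (Φ K (z * w)) (f * g) := by
  refine ⟨mul_mem_weightSupported hz.1 hw.1 ?_, ?_⟩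
  · rintro _ rfl _ rfl
    rfl
  have e : Φ K (z * w) - f * g
      = Φ K (z * w) - (Φ K z * Φ K w - pderiv 1 (Φ K z) * pderiv 0 (Φ K w))
        - pderiv 1 (Φ K z) * pderiv 0 (Φ K w) + (Φ K z - f) * Φ K w + f * (Φ K w - g) := by ring
  rw [e]
  refine Submodule.add_mem _ (Submodule.add_mem _ (Submodule.sub_mem _ ?_ ?_) ?_) ?_
  · refine weightSupported_mono ?_ (Φ_mul_sub_mem hρσ.le hz.mem_Iic hw.mem_Iic)
    intro c hc
    simp only [Set.mem_Iic, Set.mem_Iio] at hc ⊢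
    linarith
  · refine mul_mem_weightSupported (I := Set.Iic (a - σ)) (J := Set.Iic (b - ρ))
      (pderiv_one_mem_weightSupported hz.mem_Iic fun c hc => ?_)
      (pderiv_zero_mem_weightSupported hw.mem_Iic fun c hc => ?_) ?_
    · simpa using hc
    · simpa using hc
    · intro c hc d hd
      simp only [Set.mem_Iic, Set.mem_Iio] at hc hd ⊢
      linarith
  · refine mul_mem_weightSupported hz.2 hw.mem_Iic ?_
    intro c hc d hd
    simp only [Set.mem_Iic, Set.mem_Iio] at hc hd ⊢
    linarith
  · refine mul_mem_weightSupported hz.1 hw.2 ?_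
    rintro _ rfl d hd
    simp only [Set.mem_Iio] at hd ⊢
    linarith

theorem IsTop.pow (hρσ : 0 < ρ + σ) {a : ℝ} {z : WeylAlgebra K}
    {f : MvPolynomial (Fin 2) K} (hz : IsTop ρ σ a (Φ K z) f) (n : ℕ) :
    IsTop ρ σ (n * a) (Φ K (z ^ n)) (f ^ n) := by
  induction n with
  | zero =>
    rw [pow_zero, pow_zero, Φ_one]
    refine ⟨?_, by simp⟩
    simpa using X_zero_pow_mem (K := K) (ρ := ρ) (σ := σ) 0
  | succ n ih =>
    rw [pow_succ, pow_succ]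
    convert ih.mul hρσ hz using 1
    push_cast
    ring

/-- If `[z,w] = 1`, the leading components of `z` and `w` have a constant bracket. -/
theorem bracket_eq_one_of_ne_zero (hρσ : 0 < ρ + σ) {a b : ℝ} {z w : WeylAlgebra K}
    {f g : MvPolynomial (Fin 2) K} (hz : IsTop ρ σ a (Φ K z) f) (hw : IsTop ρ σ b (Φ K w) g)
    [Nontrivial K] (hzw : z * w - w * z = 1) :
    ρ + σ ≤ a + b ∧ (bracket f g ≠ 0 → bracket f g = 1 ∧ a + b = ρ + σ) := by
  classical
  set s := a + b - (ρ + σ) with hs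
  have hfg : bracket f g ∈ weightSupported K ρ σ {s} := by
    refine bracket_mem_weightSupported hz.1 hw.1 ?_
    rintro _ rfl _ rfl
    rfl
  have hone : (1 : MvPolynomial (Fin 2) K) - bracket f g ∈ weightSupported K ρ σ (Set.Iio s) := by
    have e : (1 : MvPolynomial (Fin 2) K) - bracket f g
        = Φ K (z * w - w * z) - bracket (Φ K z) (Φ K w)
          + bracket (Φ K z - f) (Φ K w) + bracket f (Φ K w - g) := by
      rw [hzw, Φ_one]
      simp only [bracket, map_sub]
      ring
    rw [e]
    refine Submodule.add_mem _ (Submodule.add_mem _ ?_ ?_) ?_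
    · refine weightSupported_mono ?_ (Φ_commutator_sub_bracket_mem hρσ.le hz.mem_Iic hw.mem_Iic)
      intro c hc
      simp only [Set.mem_Iic, Set.mem_Iio] at hc ⊢
      linarith
    · refine bracket_mem_weightSupported hz.2 hw.mem_Iic ?_
      intro c hc d hd
      simp only [Set.mem_Iic, Set.mem_Iio] at hc hd ⊢
      linarith
    · refine bracket_mem_weightSupported hz.1 hw.2 ?_
      rintro _ rfl d hd
      simp only [Set.mem_Iio] at hd ⊢
      linarith
  -- The exponent 0 has weight 0. Were s negative, neither {f,g} nor 1 − {f,g} would have a constant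
  -- term.
  have hs0 : 0 ≤ s := by
    by_contra hneg
    have h1 := coeff_eq_zero_of_mem hone (m := 0)
      (by rw [weight_zero]; simpa using (not_le.mp hneg).le)
    have h2 := coeff_eq_zero_of_mem hfg (m := 0)
      (by rw [weight_zero]; simpa using (not_le.mp hneg).ne')
    rw [coeff_sub, h2, coeff_one, if_pos rfl, sub_zero] at h1
    exact one_ne_zero h1
  refine ⟨by linarith, fun hne => ?_⟩
  obtain ⟨m, hm⟩ := ne_zero_iff.mp hne
  have hms : weight ρ σ m = s := hfg m hm
  have h1 := coeff_eq_zero_of_mem hone (m := m) (by simp [hms])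
  rw [coeff_sub, sub_eq_zero] at h1
  -- In weight s the coefficients of 1 and {f,g} agree, so a nonzero one can only sit at the
  -- exponent 0.
  have hm0 : m = 0 := by
    by_contra h'
    rw [← h1, coeff_one, if_neg (Ne.symm h')] at hm
    exact hm rfl
  have hs0' : s = 0 := by rw [← hms, hm0, weight_zero]
  refine ⟨?_, by linarith⟩
  ext n
  by_cases hn : weight ρ σ n = s
  · have := coeff_eq_zero_of_mem hone (m := n) (by simp [hn])
    rw [coeff_sub, sub_eq_zero] at this
    exact this.symm
  · rw [coeff_eq_zero_of_mem hfg (by simpa using hn), coeff_one, if_neg]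
    rintro rfl
    exact hn (by rw [weight_zero, hs0'])

end Leading

/-! ### Coefficients indexed by the integer lattice. -/

section CoeffZ

/-- An exponent as an integer vector. -/
def toZ (m : Fin 2 →₀ ℕ) : ℤ × ℤ := (m 0, m 1)

theorem toZ_add (m n : Fin 2 →₀ ℕ) : toZ (m + n) = toZ m + toZ n := by
  simp [toZ]

theorem toZ_injective : Function.Injective toZ := by
  intro m n h
  simp only [toZ, Prod.mk.injEq, Nat.cast_inj] at h
  ext i
  fin_cases i
  · exact h.1
  · exact h.2

/-- The exponent of `XⁱYʲ`. -/
noncomputable def expo (i j : ℕ) : Fin 2 →₀ ℕ := Finsupp.single 0 i + Finsupp.single 1 j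

@[simp] theorem expo_zero (i j : ℕ) : expo i j 0 = i := by simp [expo]

@[simp] theorem expo_one (i j : ℕ) : expo i j 1 = j := by simp [expo]

theorem expo_eta (m : Fin 2 →₀ ℕ) : expo (m 0) (m 1) = m := by
  ext i
  fin_cases i <;> simp

variable {K : Type*} [CommRing K]

/-- The coefficients of a polynomial, extended by zero to `ℤ²`. -/
noncomputable def coeffZ (g : MvPolynomial (Fin 2) K) (x : ℤ × ℤ) : K :=
  if 0 ≤ x.1 ∧ 0 ≤ x.2 then coeff (expo x.1.toNat x.2.toNat) g else 0

theorem coeffZ_toZ (g : MvPolynomial (Fin 2) K) (m : Fin 2 →₀ ℕ) :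
    coeffZ g (toZ m) = coeff m g := by
  simp [coeffZ, toZ, expo_eta]

theorem exists_of_coeffZ_ne_zero {g : MvPolynomial (Fin 2) K} {x : ℤ × ℤ}
    (h : coeffZ g x ≠ 0) : ∃ m, toZ m = x ∧ coeff m g ≠ 0 := by
  rw [coeffZ] at h
  split_ifs at h with hx
  · refine ⟨_, ?_, h⟩
    ext
    · simpa [toZ] using hx.1
    · simpa [toZ] using hx.2
  · exact absurd rfl h

theorem coeffZ_zero (x : ℤ × ℤ) : coeffZ (0 : MvPolynomial (Fin 2) K) x = 0 := by
  simp [coeffZ]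

theorem coeffZ_add (g h : MvPolynomial (Fin 2) K) (x : ℤ × ℤ) :
    coeffZ (g + h) x = coeffZ g x + coeffZ h x := by
  simp only [coeffZ, coeff_add]
  split_ifs <;> simp

theorem coeffZ_monomial (m : Fin 2 →₀ ℕ) (a : K) (x : ℤ × ℤ) :
    coeffZ (monomial m a) x = if x = toZ m then a else 0 := by
  classical
  split_ifs with h
  · rw [h, coeffZ_toZ, coeff_monomial, if_pos rfl]
  · by_contra h'
    obtain ⟨n, hn, hne⟩ := exists_of_coeffZ_ne_zero h'
    rw [coeff_monomial] at hne
    split_ifs at hne with hmn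
    · exact h (by rw [← hn, hmn])
    · exact hne rfl

theorem coeffZ_one (x : ℤ × ℤ) :
    coeffZ (1 : MvPolynomial (Fin 2) K) x = if x = 0 then 1 else 0 := by
  have := coeffZ_monomial (0 : Fin 2 →₀ ℕ) (1 : K) x
  rwa [show toZ 0 = 0 from rfl] at this

theorem coeffZ_X_mul_X_mul (g : MvPolynomial (Fin 2) K) (x : ℤ × ℤ) :
    coeffZ (X 0 * X 1 * g) x = coeffZ g (x - (1, 1)) := by
  induction g using MvPolynomial.induction_on' with
  | monomial m a =>
    have e : (X 0 * X 1 * monomial m a : MvPolynomial (Fin 2) K)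
        = monomial (expo 1 1 + m) a := by
      simp [X, expo, monomial_mul]
    have e1 : toZ (expo 1 1) = (1, 1) := by simp [toZ]
    rw [e, coeffZ_monomial, coeffZ_monomial, toZ_add, e1]
    simp only [sub_eq_iff_eq_add', eq_comm (a := x)]
  | add f g hf hg => rw [mul_add, coeffZ_add, coeffZ_add, hf, hg]

/-- Multiplication by XY turns the derivatives into X∂_X and Y∂_Y, which are diagonal on monomials;
the factor is the determinant of P and x. Indexing by ℤ² lets x + P − (1,1) be formed without
truncation. -/
theorem coeffZ_bracket_monomial (P : Fin 2 →₀ ℕ) (a : K) (g : MvPolynomial (Fin 2) K)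
    (x : ℤ × ℤ) :
    coeffZ (bracket (monomial P a) g) (x + toZ P - (1, 1)) =
      a * ((P 0 * x.2 - P 1 * x.1 : ℤ) : K) * coeffZ g x := by
  rw [← coeffZ_X_mul_X_mul]
  have e : X 0 * X 1 * bracket (monomial P a) g
      = (X 0 * pderiv 0 (monomial P a)) * (X 1 * pderiv 1 g)
        - (X 1 * pderiv 1 (monomial P a)) * (X 0 * pderiv 0 g) := by
    rw [bracket]; ring
  rw [e, X_mul_pderiv_monomial, X_mul_pderiv_monomial]
  clear e
  induction g using MvPolynomial.induction_on' with
  | monomial m c =>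
    have e' : (P 0 • monomial P a) * (m 1 • monomial m c)
          - (P 1 • monomial P a) * (m 0 • monomial m c)
        = monomial (m + P) (a * ((P 0 * m 1 - P 1 * m 0 : ℤ) : K) * c) := by
      have : (monomial P a * monomial m c : MvPolynomial (Fin 2) K) = monomial (m + P) (a * c) := by
        rw [monomial_mul, add_comm]
      rw [smul_mul_smul_comm, smul_mul_smul_comm, this, ← map_nsmul, ← map_nsmul, ← map_sub]
      congr 1
      simp only [nsmul_eq_mul]
      push_cast
      ring
    rw [X_mul_pderiv_monomial, X_mul_pderiv_monomial, e', coeffZ_monomial, coeffZ_monomial,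
      toZ_add]
    by_cases h : x = toZ m
    · rw [if_pos (by rw [h]), if_pos h, h]
      rfl
    · rw [if_neg (by simpa using h), if_neg h, mul_zero]
  | add g h hg hh =>
    simp only [map_add, mul_add, coeffZ_add] at hg hh ⊢
    rw [← hg, ← hh, ← coeffZ_add]
    congr 1
    ring

/-- Moving from a point of the support in a fixed direction, one leaves the support. -/
theorem exists_last_coeffZ_ne_zero {g : MvPolynomial (Fin 2) K} {x D : ℤ × ℤ}
    (hx : coeffZ g x ≠ 0) (hD : D ≠ 0) :
    ∃ n : ℕ, coeffZ g (x + n • D) ≠ 0 ∧ coeffZ g (x + (n + 1) • D) = 0 := by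
  by_contra! hcon
  have hall : ∀ n : ℕ, coeffZ g (x + n • D) ≠ 0 := by
    intro n
    induction n with
    | zero => simpa using hx
    | succ n ih => exact hcon n ih
  have hfin : {y | coeffZ g y ≠ 0}.Finite := by
    refine (g.support.finite_toSet.image toZ).subset ?_
    intro y hy
    obtain ⟨m, rfl, hm⟩ := exists_of_coeffZ_ne_zero hy
    exact ⟨m, by simpa using hm, rfl⟩
  refine Set.infinite_of_injective_forall_mem (f := fun n : ℕ => x + n • D) ?_ hall hfin
  intro n n' h
  have h1 : (n : ℤ) * D.1 = n' * D.1 := by simpa using congrArg Prod.fst h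
  have h2 : (n : ℤ) * D.2 = n' * D.2 := by simpa using congrArg Prod.snd h
  by_contra hne
  have hne' : (n : ℤ) - n' ≠ 0 := by omega
  refine hD (Prod.ext ?_ ?_)
  · exact (mul_eq_zero.mp (by linear_combination h1 : ((n : ℤ) - n') * D.1 = 0)).resolve_left hne'
  · exact (mul_eq_zero.mp (by linear_combination h2 : ((n : ℤ) - n') * D.2 = 0)).resolve_left hne'

end CoeffZ

/-! ### Brackets with binomials and monomials. -/

section Binomial

variable {K : Type*} [Field K]

/-- The coefficients of the bracket with a binomial. -/
theorem coeffZ_bracket_binomial (P Q : Fin 2 →₀ ℕ) (a b : K) (g : MvPolynomial (Fin 2) K)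
    (x : ℤ × ℤ) :
    coeffZ (bracket (monomial P a + monomial Q b) g) (x + toZ P - (1, 1)) =
      a * ((P 0 * x.2 - P 1 * x.1 : ℤ) : K) * coeffZ g x +
      b * ((Q 0 * (x.2 + P 1 - Q 1) - Q 1 * (x.1 + P 0 - Q 0) : ℤ) : K) *
        coeffZ g (x + (toZ P - toZ Q)) := by
  rw [bracket_add_left, coeffZ_add, coeffZ_bracket_monomial]
  have : x + toZ P - (1, 1) = (x + (toZ P - toZ Q)) + toZ Q - (1, 1) := by abel
  rw [this, coeffZ_bracket_monomial]
  simp only [toZ, Prod.fst_add, Prod.snd_add, Prod.fst_sub, Prod.snd_sub]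
  congr 4
  ring

variable [CharZero K]

/-- When x is the last support point of g in direction P − Q, the Q-term has nothing to cancel the
P-term with, so the determinant of P and x must vanish. -/
theorem det_eq_zero_of_last {P Q : Fin 2 →₀ ℕ} {a b : K} (ha : a ≠ 0)
    {g : MvPolynomial (Fin 2) K} {x : ℤ × ℤ}
    (h : coeffZ (bracket (monomial P a + monomial Q b) g) (x + toZ P - (1, 1)) = 0)
    (hx : coeffZ g x ≠ 0) (hx' : coeffZ g (x + (toZ P - toZ Q)) = 0) :
    (P 0 : ℤ) * x.2 - P 1 * x.1 = 0 := by
  rw [coeffZ_bracket_binomial, hx', mul_zero, add_zero] at h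
  exact_mod_cast (mul_eq_zero.mp ((mul_eq_zero.mp h).resolve_right hx)).resolve_left ha

/-- A nonzero polynomial commuting with a binomial has an exponent parallel to the first
exponent of the binomial. -/
theorem exists_parallel_of_bracket_eq_zero {P Q : Fin 2 →₀ ℕ} (hPQ : P ≠ Q) {a b : K}
    (ha : a ≠ 0) {g : MvPolynomial (Fin 2) K} (hg : g ≠ 0)
    (h : bracket (monomial P a + monomial Q b) g = 0) :
    ∃ m, coeff m g ≠ 0 ∧ (P 0 : ℤ) * m 1 - P 1 * m 0 = 0 := by
  obtain ⟨m, hm⟩ := ne_zero_iff.mp hg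
  rw [← coeffZ_toZ] at hm
  obtain ⟨n, hn, hn'⟩ := exists_last_coeffZ_ne_zero hm
    (sub_ne_zero.mpr (toZ_injective.ne hPQ))
  rw [succ_nsmul, ← add_assoc] at hn'
  have hdet := det_eq_zero_of_last ha (by rw [h, coeffZ_zero]) hn hn'
  obtain ⟨m', hm', hne⟩ := exists_of_coeffZ_ne_zero hn
  exact ⟨m', hne, by rw [← hm'] at hdet; exact hdet⟩

/-- A nonzero polynomial commuting with a binomial with independent exponents has a multiple
of the first exponent among its exponents. -/
theorem exists_nsmul_of_bracket_eq_zero {P Q : Fin 2 →₀ ℕ}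
    (hdet : (P 0 : ℤ) * Q 1 - P 1 * Q 0 ≠ 0) {a b : K} (ha : a ≠ 0) (hb : b ≠ 0)
    {g : MvPolynomial (Fin 2) K} (hg : g ≠ 0)
    (h : bracket (monomial P a + monomial Q b) g = 0) :
    ∃ n : ℕ, coeff (n • P) g ≠ 0 := by
  have hPQ : P ≠ Q := by
    rintro rfl
    exact hdet (by ring)
  obtain ⟨m, hm, hm0⟩ := exists_parallel_of_bracket_eq_zero hPQ ha hg h
  -- From m, parallel to P, walk in direction Q − P. The last point m + n(Q − P) is parallel to Q,
  -- so m − nP is parallel to both P and Q and hence zero.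
  obtain ⟨n, hn, hn'⟩ := exists_last_coeffZ_ne_zero (by rwa [coeffZ_toZ])
    (sub_ne_zero.mpr (toZ_injective.ne hPQ.symm)) (g := g) (x := toZ m)
  rw [succ_nsmul, ← add_assoc] at hn'
  rw [add_comm] at h
  have h2 := det_eq_zero_of_last hb (by rw [h, coeffZ_zero]) hn hn'
  refine ⟨n, ?_⟩
  have e : n • P = m := by
    simp only [toZ, Prod.fst_add, Prod.snd_add, Prod.smul_fst, Prod.smul_snd,
      Prod.mk_sub_mk] at h2
    simp only [nsmul_eq_mul] at h2
    have k1 : ((P 0 : ℤ) * Q 1 - P 1 * Q 0) * (n * P 0 - m 0) = 0 := by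
      linear_combination (P 0 : ℤ) * h2 - (Q 0 : ℤ) * hm0
    have k2 : ((P 0 : ℤ) * Q 1 - P 1 * Q 0) * (n * P 1 - m 1) = 0 := by
      linear_combination (P 1 : ℤ) * h2 - (Q 1 : ℤ) * hm0
    have k1' := (mul_eq_zero.mp k1).resolve_left hdet
    have k2' := (mul_eq_zero.mp k2).resolve_left hdet
    apply toZ_injective
    ext
    · simp only [toZ, Finsupp.smul_apply, smul_eq_mul]
      push_cast
      linarith
    · simp only [toZ, Finsupp.smul_apply, smul_eq_mul]
      push_cast
      linarith
  rwa [e]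

/-- A nonzero polynomial commuting with a monomial with coprime exponents has only multiples
of that exponent among its exponents. -/
theorem exists_nsmul_of_bracket_monomial_eq_zero {P : Fin 2 →₀ ℕ}
    (hP : (P 0).Coprime (P 1)) (hP0 : P 0 ≠ 0) {a : K} (ha : a ≠ 0)
    {g : MvPolynomial (Fin 2) K} (hg : g ≠ 0) (h : bracket (monomial P a) g = 0) :
    ∃ n : ℕ, coeff (n • P) g ≠ 0 := by
  obtain ⟨m, hm⟩ := ne_zero_iff.mp hg
  have hd := coeffZ_bracket_monomial P a g (toZ m)
  rw [h, coeffZ_zero, coeffZ_toZ, eq_comm, mul_eq_zero, mul_eq_zero] at hd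
  have hd' : (P 0 : ℤ) * m 1 - P 1 * m 0 = 0 := by
    exact Int.cast_eq_zero.mp ((hd.resolve_right hm).resolve_left ha)
  have hd2 : P 0 * m 1 = P 1 * m 0 := by
    have : (P 0 : ℤ) * m 1 = P 1 * m 0 := by linarith
    exact_mod_cast this
  obtain ⟨n, hn⟩ : P 0 ∣ m 0 := hP.dvd_of_dvd_mul_left ⟨m 1, hd2.symm⟩
  have hn1 : m 1 = n * P 1 := by
    apply Nat.eq_of_mul_eq_mul_left (Nat.pos_of_ne_zero hP0)
    rw [hd2, hn]
    ring
  refine ⟨n, ?_⟩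
  have e : n • P = m := by
    ext i
    fin_cases i
    · simp [hn, mul_comm]
    · simp [hn1]
  rwa [e]

end Binomial

/-! ### Modifying w until the leading bracket is nonzero. -/

section Reduction

variable {K : Type*} [Field K] {ρ σ : ℝ}

theorem ne_zero_of_commutator_eq_one {A : Type*} [Ring A] [Nontrivial A] {z w : A}
    (h : z * w - w * z = 1) : w ≠ 0 := by
  rintro rfl
  simp at h

theorem nontrivial_weylAlgebra : Nontrivial (WeylAlgebra K) :=
  (Φ K).symm.injective.nontrivial

theorem Φ_ne_zero {z : WeylAlgebra K} (hz : z ≠ 0) : Φ K z ≠ 0 := by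
  simpa using hz

theorem weight_eq_degree {h : MvPolynomial (Fin 2) K} {m : Fin 2 →₀ ℕ}
    (hm : coeff m (leadingComponent ρ σ h) ≠ 0) : weight ρ σ m = degree ρ σ h :=
  (isTop_leadingComponent h).1 m hm

theorem leadingComponent_Φ_ne_zero {z w : WeylAlgebra K} (hzw : z * w - w * z = 1) :
    leadingComponent ρ σ (Φ K w) ≠ 0 :=
  haveI := nontrivial_weylAlgebra (K := K)
  leadingComponent_ne_zero (Φ_ne_zero (ne_zero_of_commutator_eq_one hzw))

/-- If the leading component of `z` has degree at most `0`, it does not commute with that of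
`w`, as soon as anything commuting with it has an exponent of weight at most `0`. -/
theorem bracket_ne_zero_of_nonpos (hρσ : 0 < ρ + σ) {v : ℝ} {z w : WeylAlgebra K}
    {f : MvPolynomial (Fin 2) K} (hz : IsTop ρ σ v (Φ K z) f) (hv : v ≤ 0)
    (H : ∀ g, g ≠ 0 → bracket f g = 0 → ∃ m, coeff m g ≠ 0 ∧ weight ρ σ m ≤ 0)
    (hzw : z * w - w * z = 1) : bracket f (leadingComponent ρ σ (Φ K w)) ≠ 0 := by
  intro h0
  obtain ⟨m, hm, hm0⟩ := H _ (leadingComponent_Φ_ne_zero hzw) h0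
  rw [weight_eq_degree hm] at hm0
  have := (bracket_eq_one_of_ne_zero hρσ hz (isTop_leadingComponent (Φ K w)) hzw).1
  linarith

/-- If everything commuting with the leading component `f` of `z` looks like a power of `f`,
a polynomial in `z` can be subtracted from `w` so that its leading component no longer
commutes with `f`. -/
theorem exists_bracket_ne_zero_of_pos (hρσ : 0 < ρ + σ) {v : ℝ} {z w : WeylAlgebra K}
    {f : MvPolynomial (Fin 2) K} (hf : f ≠ 0) (hz : IsTop ρ σ v (Φ K z) f) (hv : 0 < v)
    {P : Fin 2 →₀ ℕ} (hP : weight ρ σ P = v)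
    (H : ∀ g, g ≠ 0 → bracket f g = 0 → ∃ n : ℕ, coeff (n • P) g ≠ 0)
    (hzw : z * w - w * z = 1) :
    ∃ w', w - w' ∈ Algebra.adjoin K {z} ∧ z * w' - w' * z = 1 ∧
      bracket f (leadingComponent ρ σ (Φ K w')) ≠ 0 := by
  classical
  by_contra! hcon
  have hex : ∀ w', w - w' ∈ Algebra.adjoin K {z} → z * w' - w' * z = 1 →
      ∃ n : ℕ, coeff (n • P) (leadingComponent ρ σ (Φ K w')) ≠ 0 := fun w' h1 h2 =>
    H _ (leadingComponent_Φ_ne_zero h2) (hcon w' h1 h2)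
  -- The least such n over all admissible w' will be contradicted by w' − c zⁿ.
  have hN : ∃ n : ℕ, ∃ w', w - w' ∈ Algebra.adjoin K {z} ∧ z * w' - w' * z = 1 ∧
      coeff (n • P) (leadingComponent ρ σ (Φ K w')) ≠ 0 := by
    obtain ⟨n, hn⟩ := hex w (by simp) hzw
    exact ⟨n, w, by simp, hzw, hn⟩
  obtain ⟨w', hw', hzw', hn⟩ := Nat.find_spec hN
  set n := Nat.find hN with hndef
  have hwt : ∀ k : ℕ, weight ρ σ (k • P) = k * v := fun k => by rw [weight_nsmul, hP]
  have hdeg : degree ρ σ (Φ K w') = n * v := by rw [← weight_eq_degree hn, hwt]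
  have hpow := hz.pow hρσ n
  -- No expansion of fⁿ is needed: fⁿ commutes with f, so `H` supplies an exponent kP, and
  -- homogeneity gives k = n.
  have hfn : coeff (n • P) (f ^ n) ≠ 0 := by
    obtain ⟨k, hk⟩ := H (f ^ n) (pow_ne_zero n hf) (bracket_pow_self f n)
    have hkn : weight ρ σ (k • P) = n * v := hpow.1 _ hk
    rw [hwt] at hkn
    have : k = n := by exact_mod_cast mul_right_cancel₀ hv.ne' hkn
    rwa [this] at hk
  set c := coeff (n • P) (leadingComponent ρ σ (Φ K w')) / coeff (n • P) (f ^ n) with hc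
  have hw₁ : w - (w' - c • z ^ n) ∈ Algebra.adjoin K {z} := by
    have : w - (w' - c • z ^ n) = (w - w') + c • z ^ n := by abel
    rw [this]
    exact add_mem hw' (Subalgebra.smul_mem _
      (pow_mem (Algebra.subset_adjoin (Set.mem_singleton z)) n) c)
  have hzw₁ : z * (w' - c • z ^ n) - (w' - c • z ^ n) * z = 1 := by
    rw [mul_sub, sub_mul, mul_smul_comm, smul_mul_assoc, ← pow_succ, ← pow_succ',
      sub_sub_sub_cancel_right, hzw']
  obtain ⟨k, hk⟩ := hex _ hw₁ hzw₁
  have hnk : n ≤ k := Nat.find_min' hN ⟨_, hw₁, hzw₁, hk⟩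
  have hk' : coeff (k • P) (Φ K (w' - c • z ^ n)) ≠ 0 := by
    rwa [(isTop_leadingComponent _).coeff_eq (weight_eq_degree hk)]
  rw [map_sub, map_smul, coeff_sub, coeff_smul] at hk'
  -- Neither w' nor zⁿ has a term of weight above nv. With minimality k = n, where c was chosen to
  -- cancel the coefficient.
  have hkn : k ≤ n := by
    have : (k : ℝ) * v ≤ n * v := by
      rw [← hwt k]
      by_cases h1 : coeff (k • P) (Φ K w') = 0
      · exact hpow.mem_Iic _ fun h2 => hk' (by rw [h1, h2, smul_zero, sub_zero])
      · rw [← hdeg]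
        exact weight_le_degree h1
    exact_mod_cast le_of_mul_le_mul_right this hv
  obtain rfl : k = n := le_antisymm hkn hnk
  apply hk'
  rw [hpow.coeff_eq (hwt _), (isTop_leadingComponent (Φ K w')).coeff_eq (weight_eq_degree hn), hc,
    smul_eq_mul, div_mul_cancel₀ _ hfn, sub_self]

end Reduction

/-! ### Recovering the generators p and q. -/

section Generation

variable {K : Type*} [Field K] {ρ σ : ℝ}

/-- The generators of `A₁`. -/
def gen (K : Type*) [CommRing K] : Fin 2 → WeylAlgebra K := ![p K, q K]

theorem basis_mem {S : Subalgebra K (WeylAlgebra K)} {m : Fin 2 →₀ ℕ}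
    (h : ∀ i, m i ≠ 0 → gen K i ∈ S) : p K ^ m 0 * q K ^ m 1 ∈ S := by
  refine mul_mem ?_ ?_
  · by_cases h0 : m 0 = 0
    · rw [h0, pow_zero]; exact one_mem S
    · exact pow_mem (h 0 h0) _
  · by_cases h0 : m 1 = 0
    · rw [h0, pow_zero]; exact one_mem S
    · exact pow_mem (h 1 h0) _

theorem eq_sum_basis (z : WeylAlgebra K) :
    z = ∑ m ∈ (Φ K z).support, coeff m (Φ K z) • (p K ^ m 0 * q K ^ m 1) := by
  conv_lhs => rw [← ofPoly_Φ z, (Φ K z).as_sum, map_sum]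
  exact Finset.sum_congr rfl fun m _ => ofPoly_monomial K m _

theorem gen_mem {S : Subalgebra K (WeylAlgebra K)} {z : WeylAlgebra K} (hz : z ∈ S) (k : Fin 2)
    (hk : coeff (Finsupp.single k 1) (Φ K z) ≠ 0)
    (h : ∀ m, m ≠ Finsupp.single k 1 → coeff m (Φ K z) ≠ 0 → ∀ i, m i ≠ 0 → gen K i ∈ S) :
    gen K k ∈ S := by
  classical
  have e := eq_sum_basis z
  rw [← Finset.add_sum_erase _ _ (mem_support_iff.mpr hk)] at e
  have hsum : ∑ m ∈ (Φ K z).support.erase (Finsupp.single k 1),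
      coeff m (Φ K z) • (p K ^ m 0 * q K ^ m 1) ∈ S := by
    refine sum_mem fun m hm => Subalgebra.smul_mem _ (basis_mem fun i hi => ?_) _
    rw [Finset.mem_erase, mem_support_iff] at hm
    exact h m hm.1 hm.2 i hi
  have h1 := sub_mem hz hsum
  conv at h1 => arg 2; arg 1; rw [e]
  rw [add_sub_cancel_right] at h1
  have h2 := Subalgebra.smul_mem S h1 (coeff (Finsupp.single k 1) (Φ K z))⁻¹
  rw [smul_smul, inv_mul_cancel₀ hk, one_smul] at h2
  fin_cases k <;> simpa [gen] using h2

theorem eq_top_of_gen_mem {S : Subalgebra K (WeylAlgebra K)} (h : ∀ i, gen K i ∈ S) : S = ⊤ := by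
  rw [eq_top_iff]
  intro z _
  rw [eq_sum_basis z]
  exact sum_mem fun m _ => Subalgebra.smul_mem _ (basis_mem fun i _ => h i) _

theorem weight_eq_of_ne {k l : Fin 2} (hkl : k ≠ l) (m : Fin 2 →₀ ℕ) :
    weight ρ σ m = weight ρ σ (Finsupp.single k 1) * m k
      + weight ρ σ (Finsupp.single l 1) * m l := by
  fin_cases k <;> fin_cases l <;> simp [weight] at hkl ⊢
  ring

theorem exponent_ext {k l : Fin 2} (hkl : k ≠ l) {m n : Fin 2 →₀ ℕ} (hk : m k = n k)
    (hl : m l = n l) : m = n := by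
  ext i
  have : i = k ∨ i = l := by omega
  rcases this with rfl | rfl <;> assumption

/-- Since X_k weighs d times X_l, the degrees give d·m_k + m_l ≤ d on exponents of z and ≤ 1 on
those of w, which leaves elementary cases. The constant e allows for the sign of the bracket when k
and l are exchanged. -/
theorem adjoin_eq_top_of_binomial (hρσ : 0 < ρ + σ) {k l : Fin 2} (hkl : k ≠ l)
    {z w : WeylAlgebra K} {f g : MvPolynomial (Fin 2) K} {a b e : K} {d : ℕ} (ha : a ≠ 0)
    (he : e ≠ 0) (hf : f = C a * X k + C b * X l ^ d)
    (hd : weight ρ σ (Finsupp.single k 1) = weight ρ σ (Finsupp.single l 1) * d)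
    (hz : IsTop ρ σ (weight ρ σ (Finsupp.single k 1)) (Φ K z) f)
    (hw : IsTop ρ σ (weight ρ σ (Finsupp.single l 1)) (Φ K w) g)
    (hbr : pderiv k f * pderiv l g - pderiv l f * pderiv k g = C e)
    {S : Subalgebra K (WeylAlgebra K)} (hzS : z ∈ S) (hwS : w ∈ S) : S = ⊤ := by
  classical
  set r := weight ρ σ (Finsupp.single k 1) with hr
  set s := weight ρ σ (Finsupp.single l 1) with hs
  have hwt : ∀ m, weight ρ σ m = r * m k + s * m l := weight_eq_of_ne hkl
  have hrs : 0 < r + s := by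
    have : r + s = ρ + σ := by
      fin_cases k <;> fin_cases l <;> simp [weight, r, s] at hkl ⊢
      ring
    linarith
  have hs0 : 0 < s := by
    rw [hd] at hrs
    have h1 : 0 < s * (d + 1) := by linarith
    exact pos_of_mul_pos_left h1 (by positivity)
  have hzm : ∀ m, coeff m (Φ K z) ≠ 0 → d * m k + m l ≤ d := by
    intro m hm
    have h1 : weight ρ σ m ≤ r := hz.mem_Iic m hm
    rw [hwt, hd] at h1
    have h2 : s * ((d : ℝ) * m k + m l) ≤ s * d := by linarith
    exact_mod_cast le_of_mul_le_mul_left h2 hs0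
  have hwm : ∀ m, coeff m (Φ K w) ≠ 0 → d * m k + m l ≤ 1 := by
    intro m hm
    have h1 : weight ρ σ m ≤ s := hw.mem_Iic m hm
    rw [hwt, hd] at h1
    have h2 : s * ((d : ℝ) * m k + m l) ≤ s * 1 := by linarith
    exact_mod_cast le_of_mul_le_mul_left h2 hs0
  have hpk : pderiv k f = C a := by
    rw [hf]
    simp [pderiv_X_of_ne hkl.symm, Derivation.leibniz_pow]
  have hpl : pderiv l f = C (b * d) * X l ^ (d - 1) := by
    rw [hf]
    simp [pderiv_X_of_ne hkl, Derivation.leibniz_pow]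
    ring
  rw [hpk, hpl] at hbr
  have hlk : Finsupp.single l d ≠ Finsupp.single k 1 := fun h => by
    simpa [hkl.symm] using DFunLike.congr_fun h k
  have hzk : coeff (Finsupp.single k 1) (Φ K z) = a := by
    rw [hz.coeff_eq rfl, hf, coeff_add, coeff_C_mul, coeff_C_mul, X_pow_eq_monomial, coeff_monomial,
      if_neg hlk, X, coeff_monomial, if_pos rfl]
    simp
  have hgl : ∀ m, coeff m (pderiv l g) = coeff (m + Finsupp.single l 1) g * (m l + 1) :=
    coeff_pderiv g
  -- Once the second generator is in `S`, so is the first.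
  have finish : 1 ≤ d → gen K l ∈ S → S = ⊤ := by
    intro hd1 hl
    have hk : gen K k ∈ S := by
      refine gen_mem hzS k (by rwa [hzk]) fun m hm hmz i hi => ?_
      have h1 := hzm m hmz
      have hmk : m k = 0 := by
        by_contra hne
        have h2 : m k = 1 := by
          have : 1 ≤ m k := Nat.one_le_iff_ne_zero.mpr hne
          nlinarith
        refine hm (exponent_ext hkl ?_ ?_)
        · simp [h2]
        · rw [h2] at h1
          simp only [Finsupp.single_apply, if_neg hkl]
          omega
      have : i = k ∨ i = l := by omega
      rcases this with rfl | rfl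
      · exact absurd hmk hi
      · exact hl
    refine eq_top_of_gen_mem fun i => ?_
    have : i = k ∨ i = l := by omega
    rcases this with rfl | rfl <;> assumption
  rcases d with _ | _ | d
  -- d = 0: X_k has weight 0, so z is affine in the k-th generator. The bracket reads a·∂_l g = e,
  -- so X_l is the only term of w involving X_l.
  · have hr0 : r = 0 := by simpa using hd
    have hk : gen K k ∈ S := by
      refine gen_mem hzS k (by rwa [hzk]) fun m hm hmz i hi => ?_
      exfalso
      have h1 := hzm m hmz
      have hml : m l = 0 := by omega
      rw [hz.coeff_eq (by rw [hwt, hml, hr0]; simp), hf, coeff_add, coeff_C_mul, X, coeff_monomial,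
        if_neg (Ne.symm hm), pow_zero, mul_one, coeff_C, mul_zero, zero_add] at hmz
      split_ifs at hmz with h2
      · rw [← h2] at hi
        exact hi rfl
      · exact hmz rfl
    have hbr' : ∀ m, a * (coeff (m + Finsupp.single l 1) g * (m l + 1)) = coeff m (C e) := by
      intro m
      rw [← hgl, ← coeff_C_mul, ← hbr]
      simp
    have hl : gen K l ∈ S := by
      refine gen_mem hwS l ?_ fun m hm hmw i hi => ?_
      · rw [hw.coeff_eq rfl]
        intro h0
        have := hbr' 0
        rw [zero_add, h0, coeff_C, if_pos rfl] at this
        exact he (by simpa using this.symm)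
      · have : i = k ∨ i = l := by omega
        rcases this with rfl | rfl
        · exact hk
        exfalso
        have h1 := hwm m hmw
        have hml : m i = 1 := by omega
        have hmk : m k ≠ 0 := fun h => hm (exponent_ext hkl
          (by simp [h, hkl.symm]) (by simp [hml]))
        rw [hw.coeff_eq (by rw [hwt, hml, hr0]; simp)] at hmw
        have hmm : Finsupp.single k (m k) + Finsupp.single i 1 = m :=
          exponent_ext hkl (by simp [hkl.symm]) (by simp [hml, hkl])
        have h2 := hbr' (Finsupp.single k (m k))
        rw [hmm, coeff_C, if_neg] at h2
        · simp [hkl, ha, hmw] at h2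
        · intro h
          exact hmk (by simpa using (DFunLike.congr_fun h k).symm)
    refine eq_top_of_gen_mem fun i => ?_
    have : i = k ∨ i = l := by omega
    rcases this with rfl | rfl <;> assumption
  -- d = 1: z and w are affine in both generators. Eliminating X_k leaves X_l with coefficient e,
  -- the determinant of the linear parts.
  · refine finish le_rfl ?_
    have hrs' : r = s := by simpa using hd
    have huS : a • w - coeff (Finsupp.single k 1) (Φ K w) • z ∈ S :=
      sub_mem (Subalgebra.smul_mem _ hwS _) (Subalgebra.smul_mem _ hzS _)
    have hu : ∀ m, coeff m (Φ K (a • w - coeff (Finsupp.single k 1) (Φ K w) • z))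
        = a * coeff m (Φ K w) - coeff (Finsupp.single k 1) (Φ K w) * coeff m (Φ K z) := by
      intro m
      rw [map_sub, map_smul, map_smul, coeff_sub, coeff_smul, coeff_smul, smul_eq_mul, smul_eq_mul]
    refine gen_mem huS l ?_ fun m hm hmu i hi => ?_
    · have h0 := congrArg (coeff 0) hbr
      have hfl : coeff (Finsupp.single l 1) (Φ K z) = b := by
        rw [hz.coeff_eq hrs'.symm, hf, coeff_add, coeff_C_mul, coeff_C_mul, X_pow_eq_monomial,
          coeff_monomial, if_pos rfl, X, coeff_monomial, if_neg (Ne.symm hlk)]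
        simp
      rw [coeff_sub, coeff_C_mul, hgl, coeff_C, if_pos rfl] at h0
      simp only [zero_add, Nat.cast_one, mul_one, Nat.sub_self, pow_zero, coeff_C_mul,
        coeff_pderiv, Finsupp.coe_zero, Pi.zero_apply, Nat.cast_zero] at h0
      rw [hu, hfl, hw.coeff_eq rfl, hw.coeff_eq hrs', mul_comm _ b, h0]
      exact he
    · exfalso
      have hle : m k + m l ≤ 1 := by
        by_cases h1 : coeff m (Φ K w) = 0
        · by_cases h2 : coeff m (Φ K z) = 0
          · exact absurd (by rw [hu, h1, h2]; ring) hmu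
          · simpa using hzm m h2
        · simpa using hwm m h1
      have hmk : m k ≠ 1 := by
        intro h1
        have : m = Finsupp.single k 1 := exponent_ext hkl (by simp [h1])
          (by simp only [Finsupp.single_apply, if_neg hkl]; omega)
        apply hmu
        rw [hu, this, hzk]
        ring
      have hml : m l ≠ 1 := fun h1 => hm (exponent_ext hkl
        (by simp only [Finsupp.single_apply, if_neg hkl.symm]; omega) (by simp [h1]))
      have : i = k ∨ i = l := by omega
      rcases this with rfl | rfl <;> omega
  -- d ≥ 2: the bound for w leaves only X_l and a constant. As ∂_l f has no constant term, the
  -- constant term of the bracket shows that X_l occurs.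
  · refine finish (by omega) (gen_mem hwS l ?_ fun m hm hmw i hi => ?_)
    · rw [hw.coeff_eq rfl]
      intro h0
      have h1 := congrArg (coeff 0) hbr
      have h2 : coeff 0 (C (b * ((d + 1 + 1 : ℕ) : K)) * X l ^ (d + 1 + 1 - 1) * pderiv k g) = 0 := by
        rw [← constantCoeff_eq]
        simp
      rw [coeff_sub, coeff_C_mul, hgl, coeff_C, if_pos rfl, h2, zero_add, h0] at h1
      exact he (by simpa using h1.symm)
    · exfalso
      have h1 := hwm m hmw
      have hmk : m k = 0 := by
        by_contra hne
        have : 1 ≤ m k := Nat.one_le_iff_ne_zero.mpr hne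
        nlinarith
      have hml : m l ≠ 1 := fun h1 => hm (exponent_ext hkl
        (by simp [hmk, hkl.symm]) (by simp [h1]))
      rw [hmk] at h1
      have : i = k ∨ i = l := by omega
      rcases this with rfl | rfl <;> omega

end Generation

/-! ### The shape of the leading component and the conclusion. -/

section Main

variable {K : Type*} [Field K] [CharZero K] {ρ σ : ℝ}

/-- A monomial that contributes to a constant bracket is a variable, and the binomial containing
it is the sum of that variable and a power of the other one. -/
theorem exponents_of_bracket_eq_one {P Q : Fin 2 →₀ ℕ} (hPQ : P ≠ Q) {a b : K} (hb : b ≠ 0)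
    {g : MvPolynomial (Fin 2) K} (h : bracket (monomial P a + monomial Q b) g = 1)
    (hP : a * ((P 0 * ((1, 1) - toZ P).2 - P 1 * ((1, 1) - toZ P).1 : ℤ) : K) *
      coeffZ g ((1, 1) - toZ P) ≠ 0) :
    ∃ k l : Fin 2, k ≠ l ∧ P = Finsupp.single k 1 ∧ Q = Finsupp.single l (Q l) := by
  obtain ⟨m, hm, hmg⟩ := exists_of_coeffZ_ne_zero (right_ne_zero_of_mul hP)
  have hdet := Int.cast_ne_zero.mp (right_ne_zero_of_mul (left_ne_zero_of_mul hP))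
  have hPm : toZ m + toZ P = (1, 1) := by rw [hm]; abel
  have hm0 : m 0 + P 0 = 1 := by
    have : (m 0 : ℤ) + P 0 = 1 := congrArg Prod.fst hPm
    exact_mod_cast this
  have hm1 : m 1 + P 1 = 1 := by
    have : (m 1 : ℤ) + P 1 = 1 := congrArg Prod.snd hPm
    exact_mod_cast this
  rw [← hm] at hdet
  simp only [toZ] at hdet
  rw [← coeffZ_toZ] at hmg
  have hD : toZ Q - toZ P ≠ 0 := sub_ne_zero.mpr (toZ_injective.ne hPQ.symm)
  obtain ⟨n, hn, hn'⟩ := exists_last_coeffZ_ne_zero hmg hD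
  rw [succ_nsmul, ← add_assoc] at hn'
  rw [add_comm] at h
  have hz : toZ m + n • (toZ Q - toZ P) + toZ Q - (1, 1) = (n + 1) • (toZ Q - toZ P) := by
    rw [← hPm, succ_nsmul]; abel
  -- At the last point the bracket coefficient sits at (n+1)(Q − P) ≠ 0, where the polynomial 1 has
  -- coefficient zero.
  have hlast := det_eq_zero_of_last hb (by
    rw [h, coeffZ_one, hz, if_neg]
    exact smul_ne_zero n.succ_ne_zero hD) hn hn'
  simp only [toZ, Prod.fst_add, Prod.snd_add, Prod.smul_fst, Prod.smul_snd,
    Prod.mk_sub_mk] at hlast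
  simp only [nsmul_eq_mul] at hlast
  -- From m + P = (1,1), both entries of P are 0 or 1. P = (0,0) and P = (1,1) give determinant 0,
  -- so P is a unit vector.
  rcases Nat.eq_zero_or_pos (P 0) with h0 | h0
  · have hP1 : P 1 = 1 := by
      by_contra hne
      have : P 1 = 0 := by omega
      simp [h0, this] at hdet
    have hm0' : m 0 = 1 := by omega
    have hm1' : m 1 = 0 := by omega
    refine ⟨1, 0, by decide, exponent_ext (k := 0) (l := 1) (by decide) (by simp [h0])
      (by simp [hP1]), exponent_ext (k := 0) (l := 1) (by decide) (by simp) ?_⟩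
    simp only [h0, hP1, hm0', hm1', Nat.cast_zero, Nat.cast_one] at hlast
    have : (Q 1 : ℤ) + n * Q 0 = 0 := by linear_combination -hlast
    have h3 : (0 : ℤ) ≤ n * Q 0 := by positivity
    simp only [Finsupp.single_apply, if_neg (show (0 : Fin 2) ≠ 1 by decide)]
    omega
  · have hP0 : P 0 = 1 := by omega
    have hP1 : P 1 = 0 := by
      by_contra hne
      have h1 : m 1 = 0 := by omega
      have h2 : m 0 = 0 := by omega
      simp [h1, h2] at hdet
    have hm0' : m 0 = 0 := by omega
    have hm1' : m 1 = 1 := by omega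
    refine ⟨0, 1, by decide, exponent_ext (k := 0) (l := 1) (by decide) (by simp [hP0])
      (by simp [hP1]), exponent_ext (k := 0) (l := 1) (by decide) ?_ (by simp)⟩
    simp only [hP0, hP1, hm0', hm1', Nat.cast_zero, Nat.cast_one] at hlast
    have : (Q 0 : ℤ) + n * Q 1 = 0 := by linear_combination hlast
    have h3 : (0 : ℤ) ≤ n * Q 1 := by positivity
    simp only [Finsupp.single_apply, if_neg (show (1 : Fin 2) ≠ 0 by decide)]
    omega

/-- An exponent parallel to P ≠ 0 is a nonnegative real multiple of P, so its weight is also ≤ 0. -/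
theorem exists_weight_nonpos {P Q : Fin 2 →₀ ℕ} (hPQ : P ≠ Q) (hP : P ≠ 0) {a b : K} (ha : a ≠ 0)
    (hv : weight ρ σ P ≤ 0) {g : MvPolynomial (Fin 2) K} (hg : g ≠ 0)
    (h : bracket (monomial P a + monomial Q b) g = 0) :
    ∃ m, coeff m g ≠ 0 ∧ weight ρ σ m ≤ 0 := by
  obtain ⟨m, hm, hdet⟩ := exists_parallel_of_bracket_eq_zero hPQ ha hg h
  refine ⟨m, hm, ?_⟩
  have hdet' : (P 0 : ℝ) * m 1 - P 1 * m 0 = 0 := by exact_mod_cast hdet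
  have hpos : 0 < (P 0 : ℝ) + P 1 := by
    have : 0 < P 0 + P 1 := by
      by_contra hne
      exact hP (exponent_ext (k := 0) (l := 1) (by decide) (by simp; omega) (by simp; omega))
    exact_mod_cast this
  have e : weight ρ σ m * ((P 0 : ℝ) + P 1) = ((m 0 : ℝ) + m 1) * weight ρ σ P := by
    simp only [weight]
    linear_combination (σ - ρ) * hdet'
  have h1 : weight ρ σ m * ((P 0 : ℝ) + P 1) ≤ 0 := by
    rw [e]
    exact mul_nonpos_of_nonneg_of_nonpos (by positivity) hv
  exact nonpos_of_mul_nonpos_left h1 hpos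

/-- For parallel P and Q, weight(P)·Q = weight(Q)·P; equal nonzero weights would give P = Q. -/
theorem det_ne_zero_of_weight_eq {P Q : Fin 2 →₀ ℕ} (hPQ : P ≠ Q)
    (hw : weight ρ σ P = weight ρ σ Q) (hv : weight ρ σ P ≠ 0) :
    (P 0 : ℤ) * Q 1 - P 1 * Q 0 ≠ 0 := by
  intro hdet
  have hdet' : (P 0 : ℝ) * Q 1 - P 1 * Q 0 = 0 := by exact_mod_cast hdet
  have h0 : weight ρ σ P * ((P 0 : ℝ) - Q 0) = 0 := by
    simp only [weight] at hw ⊢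
    linear_combination (P 0 : ℝ) * hw + σ * hdet'
  have h1 : weight ρ σ P * ((P 1 : ℝ) - Q 1) = 0 := by
    simp only [weight] at hw ⊢
    linear_combination (P 1 : ℝ) * hw - ρ * hdet'
  have h0' := sub_eq_zero.mp ((mul_eq_zero.mp h0).resolve_left hv)
  have h1' := sub_eq_zero.mp ((mul_eq_zero.mp h1).resolve_left hv)
  exact hPQ (exponent_ext (k := 0) (l := 1) (by decide) (by exact_mod_cast h0')
    (by exact_mod_cast h1'))

theorem adjoin_eq_top_of_isTop_binomial (hρσ : 0 < ρ + σ) {v : ℝ} {z w : WeylAlgebra K}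
    (hzw : z * w - w * z = 1) {P Q : Fin 2 →₀ ℕ} (hPQ : P ≠ Q) {a b : K} (ha : a ≠ 0)
    (hb : b ≠ 0) (hz : IsTop ρ σ v (Φ K z) (monomial P a + monomial Q b)) :
    Algebra.adjoin K {z, w} = ⊤ := by
  classical
  set f : MvPolynomial (Fin 2) K := monomial P a + monomial Q b with hf
  have hfP : coeff P f ≠ 0 := by
    rwa [hf, coeff_add, coeff_monomial, coeff_monomial, if_pos rfl, if_neg hPQ.symm, add_zero]
  have hfQ : coeff Q f ≠ 0 := by
    rwa [hf, coeff_add, coeff_monomial, coeff_monomial, if_neg hPQ, if_pos rfl, zero_add]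
  have hP : weight ρ σ P = v := hz.1 P hfP
  have hQ : weight ρ σ Q = v := hz.1 Q hfQ
  have hf0 : f ≠ 0 := fun h => hfP (by rw [h, coeff_zero])
  have hf' : f = monomial Q b + monomial P a := add_comm _ _
  obtain ⟨w', hww', hzw', hne⟩ : ∃ w', w - w' ∈ Algebra.adjoin K {z} ∧ z * w' - w' * z = 1 ∧
      bracket f (leadingComponent ρ σ (Φ K w')) ≠ 0 := by
    rcases le_or_gt v 0 with hv | hv
    · refine ⟨w, by simp, hzw, bracket_ne_zero_of_nonpos hρσ hz hv (fun g hg hfg => ?_) hzw⟩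
      -- Parallelism to P = 0 carries no information; Q is then nonzero and takes its place.
      by_cases hP0 : P = 0
      · exact exists_weight_nonpos hPQ.symm (fun h => hPQ (by rw [hP0, h])) hb (hQ.trans_le hv) hg
          (hf' ▸ hfg)
      · exact exists_weight_nonpos hPQ hP0 ha (hP.trans_le hv) hg hfg
    · exact exists_bracket_ne_zero_of_pos hρσ hf0 hz hv hP (fun g hg hfg =>
        exists_nsmul_of_bracket_eq_zero
          (det_ne_zero_of_weight_eq hPQ (hP.trans hQ.symm) (hP.trans_ne hv.ne')) ha hb hg hfg) hzw
  set g := leadingComponent ρ σ (Φ K w') with hg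
  have hwTop := isTop_leadingComponent (ρ := ρ) (σ := σ) (Φ K w')
  obtain ⟨hone, hdeg⟩ := (bracket_eq_one_of_ne_zero hρσ hz hwTop hzw').2 hne
  have hzS : z ∈ Algebra.adjoin K {z, w} := Algebra.subset_adjoin (by simp)
  have hwS : w' ∈ Algebra.adjoin K {z, w} := by
    have h1 : w - w' ∈ Algebra.adjoin K {z, w} := Algebra.adjoin_mono (by simp) hww'
    have h2 : w ∈ Algebra.adjoin K {z, w} := Algebra.subset_adjoin (by simp)
    simpa using sub_mem h2 h1
  have key : ∀ (P Q : Fin 2 →₀ ℕ) (a b : K), a ≠ 0 → f = monomial P a + monomial Q b →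
      weight ρ σ P = v → weight ρ σ Q = v →
      (∃ k l : Fin 2, k ≠ l ∧ P = Finsupp.single k 1 ∧ Q = Finsupp.single l (Q l)) →
      Algebra.adjoin K {z, w} = ⊤ := by
    rintro P Q a b ha hf hP hQ ⟨k, l, hkl, hPk, hQl⟩
    have hkl' : weight ρ σ (Finsupp.single k 1) + weight ρ σ (Finsupp.single l 1) = ρ + σ := by
      fin_cases k <;> fin_cases l <;> simp [weight] at hkl ⊢
      ring
    rw [← hPk, hP] at hkl'
    refine adjoin_eq_top_of_binomial hρσ hkl (a := a) (b := b) (d := Q l)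
      (e := if k = 0 then 1 else -1) (f := f) (g := g) ha (by split_ifs <;> simp) ?_ ?_ ?_ ?_ ?_
      hzS hwS
    · rw [hf, X_pow_eq_monomial, C_mul_monomial, mul_one, ← hQl, X, C_mul_monomial, mul_one, ← hPk]
    · rw [← hPk, hP, ← hQ, hQl, weight_eq_of_ne hkl]
      simp [hkl.symm]
    · rwa [← hPk, hP]
    · rwa [show weight ρ σ (Finsupp.single l 1) = degree ρ σ (Φ K w') by linarith]
    · rw [bracket] at hone
      fin_cases k <;> fin_cases l <;> simp at hkl ⊢
      · exact hone
      · rw [← hone]; ring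
  have hsum := coeffZ_bracket_binomial P Q a b g ((1, 1) - toZ P)
  rw [← hf, hone, show (1, 1) - toZ P + toZ P - (1, 1) = (0 : ℤ × ℤ) by abel, coeffZ_one,
    if_pos rfl] at hsum
  -- The constant coefficient 1 of the bracket is the sum of a P-term and a Q-term; whichever is
  -- nonzero identifies its exponent as a variable.
  by_cases hT : a * ((P 0 * ((1, 1) - toZ P).2 - P 1 * ((1, 1) - toZ P).1 : ℤ) : K) *
      coeffZ g ((1, 1) - toZ P) = 0
  · refine key Q P b a hb hf' hQ hP (exponents_of_bracket_eq_one hPQ.symm ha (hf' ▸ hone) ?_)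
    rw [hT, zero_add, show (1, 1) - toZ P + (toZ P - toZ Q) = (1, 1) - toZ Q by abel] at hsum
    intro h0
    apply one_ne_zero (α := K)
    rw [hsum, ← h0]
    simp [toZ, hg]
  · exact key P Q a b ha hf hP hQ (exponents_of_bracket_eq_one hPQ hb hone hT)

/-- The leading component of `z` is not a monomial with positive coprime exponents
when `[z,w] = 1`. -/
theorem not_isTop_monomial (hρσ : 0 < ρ + σ) {v : ℝ} {z w : WeylAlgebra K}
    (hzw : z * w - w * z = 1) {P : Fin 2 →₀ ℕ} (h0 : 1 ≤ P 0) (h1 : 1 ≤ P 1)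
    (hP : (P 0).Coprime (P 1)) {a : K} (ha : a ≠ 0) :
    ¬ IsTop ρ σ v (Φ K z) (monomial P a) := by
  classical
  intro hz
  have hPv : weight ρ σ P = v := hz.1 P (by rwa [coeff_monomial, if_pos rfl])
  have H : ∀ g, g ≠ 0 → bracket (monomial P a) g = 0 → ∃ n : ℕ, coeff (n • P) g ≠ 0 :=
    fun g hg h => exists_nsmul_of_bracket_monomial_eq_zero hP (by omega) ha hg h
  obtain ⟨w', hzw', hne⟩ : ∃ w', z * w' - w' * z = 1 ∧
      bracket (monomial P a) (leadingComponent ρ σ (Φ K w')) ≠ 0 := by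
    rcases le_or_gt v 0 with hv | hv
    · refine ⟨w, hzw, bracket_ne_zero_of_nonpos hρσ hz hv (fun g hg hfg => ?_) hzw⟩
      obtain ⟨n, hn⟩ := H g hg hfg
      refine ⟨_, hn, ?_⟩
      rw [weight_nsmul, hPv]
      exact mul_nonpos_of_nonneg_of_nonpos n.cast_nonneg hv
    · obtain ⟨w', -, h⟩ := exists_bracket_ne_zero_of_pos hρσ (by simpa using ha) hz hv hPv H hzw
      exact ⟨w', h⟩
  have hone := ((bracket_eq_one_of_ne_zero hρσ hz (isTop_leadingComponent (Φ K w')) hzw').2 hne).1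
  have hx := coeffZ_bracket_monomial P a (leadingComponent ρ σ (Φ K w')) ((1, 1) - toZ P)
  rw [hone, show (1, 1) - toZ P + toZ P - (1, 1) = (0 : ℤ × ℤ) by abel, coeffZ_one,
    if_pos rfl] at hx
  have hne' := hx ▸ one_ne_zero (α := K)
  obtain ⟨m, hm, -⟩ := exists_of_coeffZ_ne_zero (right_ne_zero_of_mul hne')
  -- Both entries of P are at least 1 and P + m = (1,1), so P = (1,1) and m = 0, where the
  -- determinant vanishes.
  have hm0 : (m 0 : ℤ) = 1 - P 0 := congrArg Prod.fst hm
  have hm1 : (m 1 : ℤ) = 1 - P 1 := congrArg Prod.snd hm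
  refine Int.cast_ne_zero.mp (right_ne_zero_of_mul (left_ne_zero_of_mul hne')) ?_
  have e0 : P 0 = 1 := by omega
  have e1 : P 1 = 1 := by omega
  simp [toZ, e0, e1]

end Main

end FirstWeyl


theorem corollary62 {K : Type*} [Field K] [CharZero K]
    (z w : FirstWeyl.WeylAlgebra K) (hz : z ≠ 0) (hzw : z * w - w * z = 1)
    (ρ σ : ℝ) (hρσ : 0 < ρ + σ)
    (f : MvPolynomial (Fin 2) K) (hf : f = FirstWeyl.associatedPoly ρ σ z) :
    ((FirstWeyl.E f).card = 2 → Algebra.adjoin K {z, w} = ⊤) ∧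
    (∀ (c : K) (i j : ℕ), c ≠ 0 → 1 ≤ i → 1 ≤ j → Nat.gcd i j = 1 →
      f = MvPolynomial.C c * MvPolynomial.X 0 ^ i * MvPolynomial.X 1 ^ j →
      Algebra.adjoin K {z, w} = ⊤) := by
  have hTop := FirstWeyl.isTop_leadingComponent (ρ := ρ) (σ := σ) (FirstWeyl.WeylAlgebra.Φ K z)
  rw [← FirstWeyl.associatedPoly, ← hf] at hTop
  constructor
  · intro hcard
    obtain ⟨P, Q, hPQ, hE⟩ := Finset.card_eq_two.mp hcard
    have hP : P ∈ f.support := by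
      change P ∈ FirstWeyl.E f
      simp [hE]
    have hQ : Q ∈ f.support := by
      change Q ∈ FirstWeyl.E f
      simp [hE]
    have hsum : f = MvPolynomial.monomial P (f.coeff P) + MvPolynomial.monomial Q (f.coeff Q) := by
      conv_lhs => rw [f.as_sum, show f.support = {P, Q} from hE, Finset.sum_pair hPQ]
    rw [hsum] at hTop
    exact FirstWeyl.adjoin_eq_top_of_isTop_binomial hρσ hzw hPQ
      (MvPolynomial.mem_support_iff.mp hP) (MvPolynomial.mem_support_iff.mp hQ) hTop
  · intro c i j hc hi hj hij hfc
    have e : f = MvPolynomial.monomial (FirstWeyl.expo i j) c := by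
      rw [hfc, MvPolynomial.monomial_eq]
      simp [Finsupp.prod_fintype, Fin.prod_univ_two, mul_assoc]
    rw [e] at hTop
    exact absurd hTop (FirstWeyl.not_isTop_monomial hρσ hzw (by simpa using hi) (by simpa using hj)
      (by simpa using hij) hc)
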